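/- Let $X$ be a finite CW complex with oriented cells and let $d\ge 0$. Let $S_d$ be the set of $d$-cells, $C_d(X;\mathbb Z)$ the cellular chains with the pairing $\langle\cdot,\cdot\rangle$ for which the $d$-cells are orthonormal, and $B_d(X;\mathbb Z)=\partial C_{d+1}(X;\mathbb Z)$, of rank $b_d$. For $V\subset S_d$ put $X_V=X^{(d-1)}\cup V$ and $V^c=S_d\setminus V$, and let $k_V:B_d(X;\mathbb Z)\subset C_d(X;\mathbb Z)\to C_d(X_V;\mathbb Z)$ be the restriction. $V$ is a *spanning coforest* if $k_V$ is an isomorphism over $\mathbb Q$; a *$k$-reduced spanning coforest* is a set obtained from a spanning coforest by deleting $k$ cells. Fix a $\mathbb Z$-basis $b_1,\dots,b_{b_d}$ of $B_d(X;\mathbb Z)$, let $M=(\langle b_i,b_j\rangle)$ be its mesh matrix, and let $\sigma_j(M)$ be the $j$-th elementary symmetric function of the eigenvalues of $M$. Adjoints $k_W^\star$ are taken with respect to $\{b_i\}$ and the cellular basis, both declared orthonormal. For $W\subset S_d$ let $x_W$ be the inclusion into $B_d(X;\mathbb Z)$ of $N_W=B_d(X;\mathbb Z)\cap C_d(X_{W^c};\mathbb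 Z)$, and let $B'[W]$ be the matrix of $x_W$ in any $\mathbb Z$-basis of $N_W$ and the basis $\{b_i\}$. Then: 1. For a spanning coforest $V$ the group $H_d(X,X_{V^c};\mathbb Z)$ is finite; let $v(V,X)$ be its order. The constant coefficient of $(-1)^{b_d}\det(t\,\mathrm{Id}-M)$ is $$\det M=\text{product of the eigenvalues of }M=\sigma_{b_d}(M)=\sum_{V\text{ spanning coforest}}v(V,X)^2,$$ and $\det(k_Vk_V^\star)=v(V,X)^2$ for every spanning coforest $V$. 2. For a $k$-reduced spanning coforest $W$, the groups $C_d(X_W;\mathbb Z)/k_W(B_d(X;\mathbb Z))$ and $H_d(X,X_{W^c};\mathbb Z)$ are finite and isomorphic; let $v(W,X)$ be their order. If $W=V\setminus I$ with $V$ a spanning coforest, $I\subset V$ and $|I|=k$, let $y_W:N_W\to C_d(X_I;\mathbb Z)$ be the restriction. Then $C_d(X_I;\mathbb Z)/y_W(N_W)$ is finite and isomorphic to the image of $H_d(X_{W^c},X_{V^c};\mathbb Z)\to H_d(X,X_{V^c};\mathbb Z)$; let $u(W,V)$ be its order. The quotient $f(W)=u(W,V)/v(V,X)$ does not depend on the choice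 of $V\supset W$, and $f(W)\,v(W,X)$ is an integer. 3. If $0\le k<b_d$, the coefficient of $(-1)^{b_d-k}t^k$ in $\det(t\,\mathrm{Id}-M)$ is $$\sigma_{b_d-k}(M)=\sum_{W\ k\text{-reduced spanning coforest}}\Big(\frac{v(V,X)}{u(W,V)}\Big)^2\det\big(B'[W]^tB'[W]\big),$$ where for each $W$ any spanning coforest $V\supset W$ may be used. Moreover, for every $k$-reduced spanning coforest $W$ and every spanning coforest $V\supset W$, $$\det(k_Wk_W^\star)=\Big(\frac{v(V,X)}{u(W,V)}\Big)^2\det\big(B'[W]^tB'[W]\big),$$ and this number is an integer. -/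

import Mathlib

universe u

noncomputable section

/-! ### Singular chains of a pair -/

namespace SingularChains

/-- Integral singular `n`-chains of a topological space `Y`. -/
abbrev Chain (n : ℕ) (Y : Type*) [TopologicalSpace Y] : Type _ :=
  C(stdSimplex ℝ (Fin (n + 1)), Y) →₀ ℤ

/-- The inclusion of the `i`-th face of the standard `(n+1)`-simplex. -/
def face (n : ℕ) (i : Fin (n + 2)) :
    C(stdSimplex ℝ (Fin (n + 1)), stdSimplex ℝ (Fin (n + 2))) :=
  ⟨stdSimplex.map i.succAbove, stdSimplex.continuous_map _⟩

variable {Y Y' : Type*} [TopologicalSpace Y] [TopologicalSpace Y']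

/-- The singular boundary map, `σ ↦ ∑ i, (-1)^i σ ∘ face i`. -/
def boundary (n : ℕ) : Chain (n + 1) Y →ₗ[ℤ] Chain n Y :=
  Finsupp.linearCombination ℤ fun σ : C(stdSimplex ℝ (Fin (n + 2)), Y) =>
    ∑ i : Fin (n + 2), Finsupp.single (σ.comp (face n i)) ((-1 : ℤ) ^ (i : ℕ))

/-- The chain map induced by a continuous map. -/
def push (n : ℕ) (f : C(Y, Y')) : Chain n Y →ₗ[ℤ] Chain n Y' :=
  Finsupp.lmapDomain ℤ ℤ fun σ => f.comp σ

/-- The singular chains with image in the subspace `A`. -/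
def chainsIn (n : ℕ) (A : Set Y) : Submodule ℤ (Chain n Y) :=
  Finsupp.supported ℤ ℤ {σ | Set.range σ ⊆ A}

/-- Relative singular cycles of the pair `(A, B)`. -/
def relCycles (A B : Set Y) : (n : ℕ) → Submodule ℤ (Chain n Y)
  | 0 => chainsIn 0 A
  | n + 1 => chainsIn (n + 1) A ⊓ (chainsIn n B).comap (boundary n)

/-- Relative singular boundaries of the pair `(A, B)`; the singular homology group `H_n(A, B; ℤ)`
is `relCycles A B n` modulo these. -/
def relBoundaries (A B : Set Y) (n : ℕ) : Submodule ℤ (Chain n Y) :=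
  chainsIn n B ⊔ (chainsIn (n + 1) A).map (boundary n)

end SingularChains

/-! ### Orientations and incidence numbers of a CW complex -/

namespace CWOrientation

open Topology SingularChains

/-- The closed unit ball of `ℝⁿ` (in the maximum norm, as in Mathlib's CW complexes). -/
abbrev Disk (n : ℕ) : Type := Metric.closedBall (0 : Fin n → ℝ) 1

/-- The boundary of the closed unit ball. -/
def diskBoundary (n : ℕ) : Set (Disk n) := {x | (x : Fin n → ℝ) ∈ Metric.sphere (0 : Fin n → ℝ) 1}

/-- `z` is a relative cycle whose class generates `H_n(Dⁿ, ∂Dⁿ; ℤ) ≅ ℤ`. -/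
def IsFundamentalCycle (n : ℕ) (z : Chain n (Disk n)) : Prop :=
  z ∈ relCycles Set.univ (diskBoundary n) n ∧
    ∀ w ∈ relCycles Set.univ (diskBoundary n) n,
      ∃ a : ℤ, w - a • z ∈ relBoundaries Set.univ (diskBoundary n) n

variable {X : Type u} [TopologicalSpace X] [T2Space X]

/-- The characteristic map of a cell on the closed ball. -/
def charMap (C : Set X) [CWComplex C] (n : ℕ) (i : RelCWComplex.cell C n) : C(Disk n, X) :=
  ⟨(Metric.closedBall 0 1).domRestrict (RelCWComplex.map n i),
    continuousOn_iff_continuous_domRestrict.1 (RelCWComplex.continuousOn n i)⟩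

/-- The union of all cells of dimension less than `n`, i.e. the skeleton `X⁽ⁿ⁻¹⁾`. -/
def cellsBelow (C : Set X) [CWComplex C] (n : ℕ) : Set X := (RelCWComplex.skeletonLT C n : Set X)

/-- An orientation of every cell: a choice of generator of `H_n(Dⁿ, ∂Dⁿ; ℤ)` for every
`n`-cell. -/
structure Orientation (C : Set X) [CWComplex C] where
  cycle (n : ℕ) (i : RelCWComplex.cell C n) : Chain n (Disk n)
  isFundamentalCycle (n : ℕ) (i : RelCWComplex.cell C n) : IsFundamentalCycle n (cycle n i)

instance cellFintype (C : Set X) [CWComplex C] [CWComplex.Finite C] (n : ℕ) :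
    Fintype (RelCWComplex.cell C n) :=
  haveI : Finite (RelCWComplex.cell C n) :=
    RelCWComplex.FiniteType.finite_cell (C := C) (D := ∅) n
  Fintype.ofFinite (RelCWComplex.cell C n)

variable {C : Set X} [CWComplex C]

/-- The singular chain in `X` representing the oriented cell `i` in `H_n(X⁽ⁿ⁾, X⁽ⁿ⁻¹⁾; ℤ)`. -/
def Orientation.cellChain (o : Orientation C) (n : ℕ) (i : RelCWComplex.cell C n) : Chain n X :=
  push n (charMap C n i) (o.cycle n i)

/-- The incidence numbers `[i : j]` of the `(n+1)`-cell `i`: the coefficients of the image of the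
oriented cell `i` under the connecting map `H_{n+1}(X⁽ⁿ⁺¹⁾, X⁽ⁿ⁾) → H_n(X⁽ⁿ⁾, X⁽ⁿ⁻¹⁾)`, written in
the basis of oriented `n`-cells. By cellular homology these coefficients exist and are unique. -/
def Orientation.incidence [CWComplex.Finite C] (o : Orientation C) (n : ℕ)
    (i : RelCWComplex.cell C (n + 1)) : RelCWComplex.cell C n → ℤ :=
  Classical.epsilon fun m : RelCWComplex.cell C n → ℤ =>
    boundary n (o.cellChain (n + 1) i) - ∑ j, m j • o.cellChain n j ∈
      relBoundaries (cellsBelow C (n + 1)) (cellsBelow C n) n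

end CWOrientation

/-! ### Cellular chains -/

/-- Finite sets of cells in every dimension with integral incidence numbers. -/
structure IncidenceSystem where
  cell : ℕ → Type u
  [fintypeCell : ∀ n, Fintype (cell n)]
  [decEqCell : ∀ n, DecidableEq (cell n)]
  incidence : ∀ n, cell (n + 1) → cell n → ℤ

attribute [instance] IncidenceSystem.fintypeCell IncidenceSystem.decEqCell

/-- The cells and incidence numbers of a finite CW complex with oriented cells. -/
def CWOrientation.Orientation.system {X : Type u} [TopologicalSpace X] [T2Space X] {C : Set X}
    [Topology.CWComplex C] [Topology.CWComplex.Finite C] (o : CWOrientation.Orientation C) :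
    IncidenceSystem.{u} where
  cell n := Topology.RelCWComplex.cell C n
  fintypeCell n := CWOrientation.cellFintype C n
  decEqCell _ := Classical.decEq _
  incidence n i j := o.incidence n i j

namespace IncidenceSystem

variable (K : IncidenceSystem.{u}) (R : Type) [CommRing R]

/-- Cellular chains `C_n(X; R)`; the cellular basis is the standard basis. -/
abbrev Chain (n : ℕ) : Type u := K.cell n → R

/-- The cellular boundary `∂_{n+1} : C_{n+1}(X; R) → C_n(X; R)`. -/
def boundary (n : ℕ) : K.Chain R (n + 1) →ₗ[R] K.Chain R n :=
  Matrix.mulVecLin (Matrix.of fun j i => (K.incidence n i j : R))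

/-- The boundaries `B_n(X; R)`. -/
def boundaries (n : ℕ) : Submodule R (K.Chain R n) := LinearMap.range (K.boundary R n)

/-- The rank `b_n` of `B_n(X; ℤ)`. -/
def boundaryRank (n : ℕ) : ℕ := Module.finrank ℤ (K.boundaries ℤ n)

/-- A set of cells (of all dimensions). -/
abbrev CellSet : Type u := Set (Σ n, K.cell n)

/-- The integral `n`-chains supported on a set of cells. -/
def chainsOn (A : K.CellSet) (n : ℕ) : Submodule ℤ (K.Chain ℤ n) where
  carrier := {c | ∀ i, c i ≠ 0 → (⟨n, i⟩ : Σ n, K.cell n) ∈ A}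
  zero_mem' := fun i h => absurd rfl h
  add_mem' := fun {a b} ha hb i h => by
    by_cases h0 : a i = 0
    · exact hb i fun h1 => h (by simp [h0, h1])
    · exact ha i h0
  smul_mem' := fun r a ha i h => ha i fun h0 => h (by simp [h0])

/-- Relative cellular cycles of the pair `(A, B)`. -/
def relCycles (A B : K.CellSet) : (n : ℕ) → Submodule ℤ (K.Chain ℤ n)
  | 0 => K.chainsOn A 0
  | n + 1 => K.chainsOn A (n + 1) ⊓ (K.chainsOn B n).comap (K.boundary ℤ n)

/-- Relative cellular boundaries of the pair `(A, B)`. -/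
def relBoundaries (A B : K.CellSet) (n : ℕ) : Submodule ℤ (K.Chain ℤ n) :=
  K.chainsOn B n ⊔ (K.chainsOn A (n + 1)).map (K.boundary ℤ n)

/-- The cellular homology group `H_n(A, B; ℤ)` of a pair of subcomplexes. -/
abbrev RelHomology (A B : K.CellSet) (n : ℕ) : Type u :=
  K.relCycles A B n ⧸ (K.relBoundaries A B n).submoduleOf (K.relCycles A B n)

variable {K}

lemma chainsOn_mono {A A' : K.CellSet} (h : A ⊆ A') (n : ℕ) : K.chainsOn A n ≤ K.chainsOn A' n :=
  fun _ hc i hi => h (hc i hi)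

lemma relCycles_mono {A A' : K.CellSet} (h : A ⊆ A') (B : K.CellSet) :
    ∀ n, K.relCycles A B n ≤ K.relCycles A' B n
  | 0 => chainsOn_mono h 0
  | n + 1 => inf_le_inf_right _ (chainsOn_mono h (n + 1))

lemma relBoundaries_mono {A A' : K.CellSet} (h : A ⊆ A') (B : K.CellSet) (n : ℕ) :
    K.relBoundaries A B n ≤ K.relBoundaries A' B n :=
  sup_le_sup_left (Submodule.map_mono (chainsOn_mono h (n + 1))) _

/-- The map `H_n(A, B; ℤ) → H_n(A', B; ℤ)` induced by an inclusion `A ⊆ A'`. -/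
def relHomologyMap {A A' : K.CellSet} (h : A ⊆ A') (B : K.CellSet) (n : ℕ) :
    K.RelHomology A B n →ₗ[ℤ] K.RelHomology A' B n :=
  Submodule.mapQ _ _ (Submodule.inclusion (relCycles_mono h B n))
    fun _ hx => relBoundaries_mono h B n hx

variable {d : ℕ}

/-- The subcomplex `X_V = X⁽ᵈ⁻¹⁾ ∪ V` for a set `V` of `d`-cells. -/
def skeletonWith (V : Finset (K.cell d)) : K.CellSet :=
  {s | s.1 < d} ∪ Sigma.mk d '' (V : Set (K.cell d))

/-- The restriction `C_d(X; R) → C_d(X_V; R)`. -/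
def restrict (V : Finset (K.cell d)) : K.Chain R d →ₗ[R] (V → R) :=
  LinearMap.funLeft R R Subtype.val

/-- The map `k_V : B_d(X; R) ⊆ C_d(X; R) → C_d(X_V; R)`. -/
def kMap (V : Finset (K.cell d)) : K.boundaries R d →ₗ[R] (V → R) :=
  (restrict R V).comp (K.boundaries R d).subtype

/-- `V` is a `d`-dimensional spanning coforest. -/
def IsSpanningCoforest (V : Finset (K.cell d)) : Prop := Function.Bijective (kMap ℚ V)

/-- `W` arises by deleting `k` cells from some spanning coforest. -/
def IsReducedCoforest (k : ℕ) (W : Finset (K.cell d)) : Prop :=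
  ∃ V : Finset (K.cell d), IsSpanningCoforest V ∧ W ⊆ V ∧ (V \ W).card = k

variable (K d)

/-- The finite set of all `k`-reduced spanning coforests of dimension `d`. -/
def reducedCoforests (k : ℕ) : Finset (Finset (K.cell d)) :=
  haveI := Classical.decPred (IsReducedCoforest (K := K) (d := d) k)
  Finset.univ.filter (IsReducedCoforest k)

/-- The finite set of all spanning coforests of dimension `d`. -/
def spanningCoforests : Finset (Finset (K.cell d)) :=
  haveI := Classical.decPred (IsSpanningCoforest (K := K) (d := d))
  Finset.univ.filter IsSpanningCoforest

variable {K d}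

/-- `H_d(X, X_{Vᶜ}; ℤ)`. -/
abbrev HomologyRelCompl (V : Finset (K.cell d)) : Type u :=
  K.RelHomology Set.univ (skeletonWith Vᶜ) d

/-- `v(V, X)`, the order of `H_d(X, X_{Vᶜ}; ℤ)`. -/
def v (V : Finset (K.cell d)) : ℕ := Nat.card (HomologyRelCompl V)

/-- The boundaries of `X` lying in `X_{Wᶜ}`, i.e. `B_d(X; ℤ) ∩ C_d(X_{Wᶜ}; ℤ)`, as a subgroup of
`B_d(X; ℤ)`; its inclusion is `x_W`. -/
def boundariesOff (W : Finset (K.cell d)) : Submodule ℤ (K.boundaries ℤ d) :=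
  (K.chainsOn (skeletonWith Wᶜ) d).comap (K.boundaries ℤ d).subtype

/-- The restriction `y_W : B_d(X; ℤ) ∩ C_d(X_{Wᶜ}; ℤ) → C_d(X_I; ℤ)`, where `I = V \ W`. -/
def yMap (W V : Finset (K.cell d)) : boundariesOff W →ₗ[ℤ] ((V \ W : Finset (K.cell d)) → ℤ) :=
  (kMap ℤ (V \ W)).comp (boundariesOff W).subtype

/-- The cokernel `C_d(X_I; ℤ) / y_W(B_d(X; ℤ) ∩ C_d(X_{Wᶜ}; ℤ))`, where `I = V \ W`. -/
abbrev YCokernel (W V : Finset (K.cell d)) : Type u :=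
  ((V \ W : Finset (K.cell d)) → ℤ) ⧸ LinearMap.range (yMap W V)

/-- `u(W, V)`, the order of the cokernel of `y_W`. -/
def u (W V : Finset (K.cell d)) : ℕ := Nat.card (YCokernel W V)

section Basis

variable {n m : ℕ} (b : Module.Basis (Fin n) ℤ (K.boundaries ℤ d))

/-- The boundary mesh matrix `⟨b_i, b_j⟩` of a basis of `B_d(X; ℤ)`. -/
def meshMatrix : Matrix (Fin n) (Fin n) ℤ :=
  Matrix.of fun i j => (b i : K.Chain ℤ d) ⬝ᵥ (b j : K.Chain ℤ d)

/-- The eigenvalues of the mesh matrix, with multiplicities. -/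
def meshEigenvalues : Multiset ℂ := ((meshMatrix b).map (Int.cast : ℤ → ℂ)).charpoly.roots

/-- The matrix of `k_W : B_d(X; ℤ) → C_d(X_W; ℤ)` in the basis `b` and the cellular basis. -/
def kMatrix (W : Finset (K.cell d)) : Matrix W (Fin n) ℤ :=
  LinearMap.toMatrix b (Pi.basisFun ℤ W) (kMap ℤ W)

/-- The covolume squared `det(k_W k_W^*)`; the bases being orthonormal, the adjoint is given by
the transpose. -/
def covolumeSq (W : Finset (K.cell d)) : ℤ := (kMatrix b W * (kMatrix b W).transpose).det

/-- The matrix `B'[W]` of the inclusion `x_W` in a basis `c` of `B_d(X; ℤ) ∩ C_d(X_{Wᶜ}; ℤ)` and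
the basis `b` of `B_d(X; ℤ)`. -/
def inclMatrix {W : Finset (K.cell d)} (c : Module.Basis (Fin m) ℤ (boundariesOff W)) :
    Matrix (Fin n) (Fin m) ℤ :=
  LinearMap.toMatrix c b (boundariesOff W).subtype

/-- `det(B'[W]ᵗ B'[W])`. -/
def inclGram {W : Finset (K.cell d)} (c : Module.Basis (Fin m) ℤ (boundariesOff W)) : ℤ :=
  ((inclMatrix b c).transpose * inclMatrix b c).det

end Basis

end IncidenceSystem

end

/-! Let A be the matrix of B_d ⊂ C_d in the basis b and the cells, so that M = AᵀA. By Cauchy–Binet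
(`charpoly_coeff_transpose_mul_self`) the signed coefficient of t^k is the sum, over sets W of b_d −
k cells, of the Gram determinants det(k_W k_W*). Such a determinant is nonzero exactly when the rows
indexed by W are independent over ℚ, that is, when W extends to a row basis, which is a spanning
coforest. This leaves the k-reduced ones (`charpoly_coeff_meshMatrix`).

The group H_d(X, X_{Vᶜ}) is the cokernel of k_V, so v(V) = |det k_V| for a coforest V. For W ⊆ V the
exact sequence 0 → coker y_W → coker k_V → coker k_W → 0 gives v(V) = v(W) u(W,V) (`v_eq_v_mul_u`),
whence f(W) = 1/v(W).

For the covolume of W, let P and Q be the rows of k_V in W and in V \ W, and c = B'[W]. Since Pc =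
0, multiplying the square matrix with row blocks P, Q by T = (Pᵀ | c) gives a block triangular
product, while TᵀT is block diagonal. Comparing determinants yields v(V)² det(cᵀc) = det(PPᵀ)
u(W,V)² (`det_fromRows_sq_mul_gram`). -/

namespace Matrix

/-! ### Gram determinants and indices of lattices -/

/-- The coefficients of the characteristic polynomial of `AᵀA` are, up to sign, sums of Gram
determinants of families of rows of `A` (a form of the Cauchy–Binet formula). -/
theorem charpoly_coeff_transpose_mul_self {R m n : Type*} [CommRing R] [Fintype m] [DecidableEq m]
    [Fintype n] [DecidableEq n] (A : Matrix m n R) {j : ℕ} (hj : j ≤ Fintype.card n) :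
    (Aᵀ * A).charpoly.coeff (Fintype.card n - j) =
      (-1) ^ j * ∑ s ∈ Finset.univ.powersetCard j,
        (A.submatrix (Subtype.val : s → m) id * (A.submatrix (Subtype.val : s → m) id)ᵀ).det := by
  rw [charpoly_coeff_eq_sum_minors _ _ hj, ← coeff_det_one_add_X_smul_eq_sum_minors]
  -- Sylvester's identity replaces AᵀA by AAᵀ, whose principal minors are the Gram determinants of
  -- rows of A.
  have h : (1 + (Polynomial.X : Polynomial R) • (Aᵀ * A).map Polynomial.C).det =
      (1 + (Polynomial.X : Polynomial R) • (A * Aᵀ).map Polynomial.C).det := by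
    rw [Matrix.map_mul, Matrix.map_mul, ← Matrix.smul_mul, det_one_add_mul_comm, Matrix.mul_smul]
  rw [h, coeff_det_one_add_X_smul_eq_sum_minors]
  rfl

/-- If the rows of `P` are orthogonal to the columns of `c`, then the Gram determinants of `P` and
of `c` are related through the square matrix with rows `P` and `Q`. -/
theorem det_fromRows_sq_mul_gram {R m p q : Type*} [CommRing R] [IsDomain R] [Fintype m]
    [DecidableEq m] [Fintype p] [DecidableEq p] [Fintype q] [DecidableEq q]
    (P : Matrix p m R) (Q : Matrix q m R) (c : Matrix m q R) (e : p ⊕ q ≃ m) (hPc : P * c = 0)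
    (hP : (P * Pᵀ).det ≠ 0) :
    ((fromRows P Q).submatrix id e).det ^ 2 * (cᵀ * c).det =
      (P * Pᵀ).det * (Q * c).det ^ 2 := by
  have hcP : cᵀ * Pᵀ = 0 := by rw [← transpose_mul, hPc, transpose_zero]
  set T : Matrix (p ⊕ q) (p ⊕ q) R := (fromCols Pᵀ c).submatrix e id with hT
  have h1 : ((fromRows P Q).submatrix id e).det * T.det = (P * Pᵀ).det * (Q * c).det := by
    rw [← det_mul, hT, submatrix_mul_equiv, fromRows_mul_fromCols, hPc, submatrix_id_id,
      det_fromBlocks_zero₁₂]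
  -- TᵀT is block diagonal because P and c are orthogonal.
  have h2 : T.det ^ 2 = (P * Pᵀ).det * (cᵀ * c).det := by
    rw [sq]
    nth_rewrite 1 [← det_transpose]
    rw [← det_mul, hT, transpose_submatrix, submatrix_mul_equiv, transpose_fromCols,
      fromRows_mul_fromCols, transpose_transpose, hPc, hcP, submatrix_id_id,
      det_fromBlocks_zero₁₂]
  apply mul_left_cancel₀ hP
  calc _ = ((fromRows P Q).submatrix id e).det ^ 2 * T.det ^ 2 := by rw [h2]; ring
    _ = _ := by rw [← mul_pow, h1]; ring

/-- The rows of a matrix over an ordered field are independent iff their Gram determinant is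
nonzero. -/
theorem linearIndependent_row_iff_det_mul_transpose_ne_zero {R m p : Type*} [Field R]
    [LinearOrder R] [IsStrictOrderedRing R] [Fintype m] [Fintype p] [DecidableEq p]
    (P : Matrix p m R) : LinearIndependent R P.row ↔ (P * Pᵀ).det ≠ 0 := by
  rw [← isUnit_iff_ne_zero, ← isUnit_iff_isUnit_det, ← linearIndependent_rows_iff_isUnit,
    ← vecMul_injective_iff, ← vecMul_injective_iff]
  simp only [← coe_vecMulLinear, injective_iff_map_eq_zero]
  simp only [vecMulLinear_apply]
  refine ⟨fun h x hx => h x ?_, fun h x hx => h x (by rw [← vecMul_vecMul, hx, zero_vecMul])⟩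
  -- If xPPᵀ = 0, then xP has square length zero, so xP = 0 over an ordered field.
  rw [← dotProduct_self_eq_zero]
  nth_rewrite 2 [← mulVec_transpose]
  rw [dotProduct_mulVec, vecMul_vecMul, hx, zero_dotProduct]

end Matrix

/-- The cokernel of an injective map of free abelian groups of equal rank has order the absolute
value of the determinant. -/
theorem card_quotient_range_eq_natAbs_det {M ι n : Type*} [AddCommGroup M] [Fintype ι]
    [DecidableEq ι] [Fintype n] [DecidableEq n] (b : Module.Basis n ℤ M) (f : M →ₗ[ℤ] (ι → ℤ))
    (hf : Function.Injective f) (e : ι ≃ n) :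
    Nat.card ((ι → ℤ) ⧸ LinearMap.range f) =
      ((LinearMap.toMatrix b (Pi.basisFun ℤ ι) f).submatrix id e).det.natAbs := by
  rw [← Submodule.natAbs_det_basis_change (Pi.basisFun ℤ ι) _
    ((b.map (LinearEquiv.ofInjective f hf)).reindex e.symm), Module.Basis.det_apply]
  congr 2
  ext i j

  simp [Module.Basis.toMatrix_apply, LinearMap.toMatrix_apply]

/-! ### Relative homology as cokernels of restriction maps -/

namespace IncidenceSystem

variable {K : IncidenceSystem.{u}} {d : ℕ} {V W : Finset (K.cell d)}

lemma mem_skeletonWith_iff {i : K.cell d} :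
    (⟨d, i⟩ : Σ n, K.cell n) ∈ skeletonWith V ↔ i ∈ V := by
  simp [skeletonWith]

lemma mem_chainsOn_skeletonWith_compl_iff {x : K.Chain ℤ d} :
    x ∈ K.chainsOn (skeletonWith Vᶜ) d ↔ ∀ i ∈ V, x i = 0 := by
  refine forall_congr' fun i => ?_
  rw [mem_skeletonWith_iff, Finset.mem_compl]
  tauto

lemma chainsOn_skeletonWith_compl : K.chainsOn (skeletonWith Vᶜ) d = LinearMap.ker (restrict ℤ V) := by
  ext x
  rw [mem_chainsOn_skeletonWith_compl_iff, LinearMap.mem_ker, funext_iff, Subtype.forall]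
  rfl

lemma chainsOn_univ (n : ℕ) : K.chainsOn Set.univ n = ⊤ :=
  eq_top_iff.2 fun _ _ _ _ => Set.mem_univ _

/-- The boundary of a d-chain has degree d − 1, where the subcomplex already contains every cell, so
the cycle condition is vacuous. -/
lemma relCycles_skeletonWith (A : K.CellSet) (V : Finset (K.cell d)) :
    K.relCycles A (skeletonWith V) d = K.chainsOn A d := by
  cases d with
  | zero => rfl
  | succ n =>
    refine inf_eq_left.2 fun x _ i _ => ?_
    left
    exact Nat.lt_succ_self n

lemma relBoundaries_univ (B : K.CellSet) :
    K.relBoundaries Set.univ B d = K.chainsOn B d ⊔ K.boundaries ℤ d := by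
  rw [relBoundaries, chainsOn_univ, Submodule.map_top, boundaries]

lemma restrict_surjective (V : Finset (K.cell d)) : Function.Surjective (restrict ℤ V) :=
  LinearMap.funLeft_surjective_of_injective ℤ ℤ _ Subtype.val_injective

/-- Chains off V form the kernel of restriction to V; adding this kernel to B_d gives the full
preimage of the restricted boundaries. -/
lemma relBoundaries_univ_skeletonWith_compl (V : Finset (K.cell d)) :
    K.relBoundaries Set.univ (skeletonWith Vᶜ) d =
      (LinearMap.range (kMap ℤ V)).comap (restrict ℤ V) := by
  rw [relBoundaries_univ, kMap, LinearMap.range_comp, Submodule.range_subtype,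
    Submodule.comap_map_eq, chainsOn_skeletonWith_compl, sup_comm]

/-- The cokernel `C_d(X_V; ℤ) / k_V(B_d(X; ℤ))`. -/
abbrev KCokernel (V : Finset (K.cell d)) : Type u := (V → ℤ) ⧸ LinearMap.range (kMap ℤ V)

/-- The map on relative cycles that induces `homologyRelComplEquiv`. -/
noncomputable def relCyclesToKCokernel (V : Finset (K.cell d)) :
    K.relCycles Set.univ (skeletonWith Vᶜ) d →ₗ[ℤ] KCokernel V :=
  (Submodule.mkQ _ ∘ₗ restrict ℤ V) ∘ₗ Submodule.subtype _

lemma relCyclesToKCokernel_surjective (V : Finset (K.cell d)) :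
    Function.Surjective (relCyclesToKCokernel V) := by
  intro y
  obtain ⟨x, rfl⟩ := ((Submodule.mkQ_surjective _).comp (restrict_surjective V)) y
  exact ⟨⟨x, by rw [relCycles_skeletonWith, chainsOn_univ]; trivial⟩, rfl⟩

lemma ker_relCyclesToKCokernel (V : Finset (K.cell d)) :
    LinearMap.ker (relCyclesToKCokernel V) =
      (K.relBoundaries Set.univ (skeletonWith Vᶜ) d).submoduleOf _ := by
  rw [relBoundaries_univ_skeletonWith_compl, relCyclesToKCokernel, LinearMap.ker_comp,
    LinearMap.ker_comp, Submodule.ker_mkQ, Submodule.submoduleOf]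

/-- `H_d(X, X_{Vᶜ}; ℤ)` is the cokernel of `k_V`. -/
noncomputable def homologyRelComplEquiv (V : Finset (K.cell d)) : HomologyRelCompl V ≃ₗ[ℤ] KCokernel V :=
  (Submodule.quotEquivOfEq _ _ (ker_relCyclesToKCokernel V).symm).trans
    ((relCyclesToKCokernel V).quotKerEquivOfSurjective (relCyclesToKCokernel_surjective V))

lemma v_eq_card_kCokernel (V : Finset (K.cell d)) : v V = Nat.card (KCokernel V) :=
  Nat.card_congr (homologyRelComplEquiv V).toEquiv

/-- Extension by zero of chains supported on `V \ W`. -/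
noncomputable def extendDiff (W V : Finset (K.cell d)) : ((V \ W : Finset (K.cell d)) → ℤ) →ₗ[ℤ] (V → ℤ) :=
  LinearMap.pi fun i =>
    if h : (i : K.cell d) ∈ V \ W then LinearMap.proj (⟨i, h⟩ : (V \ W : Finset (K.cell d))) else 0

lemma extendDiff_apply_of_mem (x : (V \ W : Finset (K.cell d)) → ℤ) {i : V} (h : (i : K.cell d) ∈ W) :
    extendDiff W V x i = 0 := by
  simp [extendDiff, h]

lemma extendDiff_apply (x : (V \ W : Finset (K.cell d)) → ℤ) (i : (V \ W : Finset (K.cell d))) :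
    extendDiff W V x ⟨i, (Finset.mem_sdiff.1 i.2).1⟩ = x i := by
  simp [extendDiff, (Finset.mem_sdiff.1 i.2).2]

lemma extendDiff_eq_iff {x : (V \ W : Finset (K.cell d)) → ℤ} {y : V → ℤ} :
    extendDiff W V x = y ↔ (∀ i : V, (i : K.cell d) ∈ W → y i = 0) ∧
      ∀ i : (V \ W : Finset (K.cell d)), x i = y ⟨i, (Finset.mem_sdiff.1 i.2).1⟩ := by
  constructor
  · rintro rfl
    exact ⟨fun i h => extendDiff_apply_of_mem x h, fun i => (extendDiff_apply x i).symm⟩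
  · rintro ⟨h1, h2⟩
    ext i
    by_cases h : (i : K.cell d) ∈ W
    · rw [extendDiff_apply_of_mem x h, h1 i h]
    · have hi := Finset.mem_sdiff.2 ⟨i.2, h⟩
      exact (extendDiff_apply x ⟨i, hi⟩).trans (h2 ⟨i, hi⟩)

/-- The map `C_d(X_{V \ W}; ℤ) → C_d(X_V; ℤ) / k_V(B_d(X; ℤ))`. -/
noncomputable def diffToKCokernel (W V : Finset (K.cell d)) :
    ((V \ W : Finset (K.cell d)) → ℤ) →ₗ[ℤ] KCokernel V :=
  Submodule.mkQ _ ∘ₗ extendDiff W V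

/-- If an extension by zero equals k_V z, then z vanishes on W; thus z lies in N_W and the given
chain is y_W z. -/
lemma ker_diffToKCokernel (h : W ⊆ V) :
    LinearMap.ker (diffToKCokernel W V) = LinearMap.range (yMap W V) := by
  rw [diffToKCokernel, LinearMap.ker_comp, Submodule.ker_mkQ]
  ext x
  simp only [Submodule.mem_comap, LinearMap.mem_range]
  constructor
  · rintro ⟨z, hz⟩
    obtain ⟨h1, h2⟩ := extendDiff_eq_iff.1 hz.symm
    refine ⟨⟨z, ?_⟩, funext fun i => (h2 i).symm⟩
    exact mem_chainsOn_skeletonWith_compl_iff.2 fun i hi => h1 ⟨i, h hi⟩ hi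
  · rintro ⟨z, rfl⟩
    refine ⟨z.1, (extendDiff_eq_iff.2 ⟨fun i hi => ?_, fun i => rfl⟩).symm⟩
    exact mem_chainsOn_skeletonWith_compl_iff.1 z.2 i hi

/-- The cokernel of `y_W` embeds into that of `k_V`. -/
noncomputable def yCokernelEquiv (h : W ⊆ V) : YCokernel W V ≃ₗ[ℤ] LinearMap.range (diffToKCokernel W V) :=
  (Submodule.quotEquivOfEq _ _ (ker_diffToKCokernel h).symm).trans
    (diffToKCokernel W V).quotKerEquivRange

lemma restrict_eq_extendDiff {x : K.Chain ℤ d} (hx : ∀ i ∈ W, x i = 0) :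
    restrict ℤ V x = extendDiff W V (restrict ℤ (V \ W) x) :=
  (extendDiff_eq_iff.2 ⟨fun i hi => hx i hi, fun _ => rfl⟩).symm

/-- Relative d-cycles of (X_{Wᶜ}, X_{Vᶜ}) are the d-chains vanishing on W, and their restrictions to
V are exactly the extensions by zero from V \ W. -/
lemma map_range_relHomologyMap (W V : Finset (K.cell d)) :
    (LinearMap.range (relHomologyMap (Set.subset_univ (skeletonWith Wᶜ)) (skeletonWith Vᶜ) d)).map
      (homologyRelComplEquiv V : HomologyRelCompl V →ₗ[ℤ] KCokernel V) =
      LinearMap.range (diffToKCokernel W V) := by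
  rw [← LinearMap.range_comp]
  apply le_antisymm
  · rintro _ ⟨z, rfl⟩
    obtain ⟨z, rfl⟩ := Submodule.Quotient.mk_surjective _ z
    have hz : (z : K.Chain ℤ d) ∈ K.chainsOn (skeletonWith Wᶜ) d := by
      rw [← relCycles_skeletonWith _ Vᶜ]; exact z.2
    refine ⟨restrict ℤ (V \ W) z, ?_⟩
    change Submodule.Quotient.mk _ = Submodule.Quotient.mk (restrict ℤ V (z : K.Chain ℤ d))
    rw [restrict_eq_extendDiff (V := V) (mem_chainsOn_skeletonWith_compl_iff.1 hz)]
  · rintro _ ⟨x, rfl⟩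
    obtain ⟨z, hz⟩ := restrict_surjective V (extendDiff W V x)
    -- The arbitrary lift z is reset to zero on all of W; its restriction to V is unaffected, being
    -- zero on W already.
    let z' : K.Chain ℤ d := fun i => if i ∈ W then 0 else z i
    have hz' : ∀ i ∈ W, z' i = 0 := fun i hi => if_pos hi
    have hzV : restrict ℤ V z' = extendDiff W V x := by
      ext i
      by_cases hi : (i : K.cell d) ∈ W
      · rw [extendDiff_apply_of_mem x hi]; exact hz' i hi
      · rw [← hz]; exact if_neg hi
    refine ⟨Submodule.Quotient.mk ⟨z', ?_⟩, ?_⟩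
    · rw [relCycles_skeletonWith]; exact mem_chainsOn_skeletonWith_compl_iff.2 hz'
    · change Submodule.Quotient.mk (restrict ℤ V z') = Submodule.Quotient.mk _
      rw [hzV]

/-- The cokernel of `y_W` is the image of `H_d(X_{Wᶜ}, X_{Vᶜ}; ℤ) → H_d(X, X_{Vᶜ}; ℤ)`. -/
noncomputable def yCokernelEquivRange (h : W ⊆ V) : YCokernel W V ≃ₗ[ℤ] LinearMap.range
    (relHomologyMap (Set.subset_univ (skeletonWith Wᶜ)) (skeletonWith Vᶜ) d) :=
  (yCokernelEquiv h).trans <|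
    (LinearEquiv.ofEq _ _ (map_range_relHomologyMap W V).symm).trans
      ((homologyRelComplEquiv V).submoduleMap _).symm

/-- The restriction `C_d(X_V; ℤ) → C_d(X_W; ℤ)` for `W ⊆ V`. -/
noncomputable def restrictOfSubset (h : W ⊆ V) : (V → ℤ) →ₗ[ℤ] (W → ℤ) :=
  LinearMap.funLeft ℤ ℤ fun i => ⟨i, h i.2⟩

lemma restrictOfSubset_surjective (h : W ⊆ V) : Function.Surjective (restrictOfSubset h) :=
  LinearMap.funLeft_surjective_of_injective ℤ ℤ _ fun _ _ e =>
    Subtype.ext (congrArg (fun i : V => (i : K.cell d)) e)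

/-- The map of cokernels `C_d(X_V; ℤ) / k_V(B_d) → C_d(X_W; ℤ) / k_W(B_d)` for `W ⊆ V`. -/
noncomputable def kCokernelMap (h : W ⊆ V) : KCokernel V →ₗ[ℤ] KCokernel W :=
  Submodule.mapQ _ _ (restrictOfSubset h) <| by
    rintro _ ⟨z, rfl⟩
    exact ⟨z, rfl⟩

lemma kCokernelMap_surjective (h : W ⊆ V) : Function.Surjective (kCokernelMap h) := by
  intro y
  obtain ⟨y, rfl⟩ := Submodule.Quotient.mk_surjective _ y
  obtain ⟨x, rfl⟩ := restrictOfSubset_surjective h y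
  exact ⟨Submodule.Quotient.mk x, rfl⟩

/-- A class dies when its representative agrees on W with some k_V z; subtracting k_V z leaves a
chain supported on V \ W. This is exactness in the middle of 0 → coker y_W → coker k_V → coker k_W →
0. -/
lemma ker_kCokernelMap (h : W ⊆ V) :
    LinearMap.ker (kCokernelMap h) = LinearMap.range (diffToKCokernel W V) := by
  apply le_antisymm
  · intro x hx
    obtain ⟨x, rfl⟩ := Submodule.Quotient.mk_surjective _ x
    obtain ⟨z, hz⟩ := (Submodule.Quotient.mk_eq_zero _).1 (LinearMap.mem_ker.1 hx)
    refine ⟨fun i => (x - kMap ℤ V z) ⟨i, (Finset.mem_sdiff.1 i.2).1⟩, ?_⟩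
    change Submodule.Quotient.mk (extendDiff W V _) = _
    rw [extendDiff_eq_iff (y := x - kMap ℤ V z) |>.2 ⟨fun i hi => ?_, fun _ => rfl⟩]
    · rw [Submodule.Quotient.mk_sub, sub_eq_self, Submodule.Quotient.mk_eq_zero]
      exact ⟨z, rfl⟩
    · exact sub_eq_zero.2 (congrFun hz ⟨i, hi⟩).symm
  · rintro _ ⟨x, rfl⟩
    refine (Submodule.Quotient.mk_eq_zero _).2 ?_
    convert Submodule.zero_mem _
    ext i
    exact extendDiff_apply_of_mem x i.2

/-- The orders of the cokernels are multiplicative: `v(V, X) = v(W, X) u(W, V)`. -/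
lemma v_eq_v_mul_u (h : W ⊆ V) : v V = v W * u W V := by
  -- No finiteness is needed: with `Nat.card` equal to 0 on infinite groups, the product formula
  -- always holds.
  rw [v_eq_card_kCokernel, v_eq_card_kCokernel,
    Submodule.card_eq_card_quotient_mul_card (LinearMap.ker (kCokernelMap h)), mul_comm,
    Nat.card_congr ((kCokernelMap h).quotKerEquivOfSurjective (kCokernelMap_surjective h)).toEquiv,
    ker_kCokernelMap, u, Nat.card_congr (yCokernelEquiv h).toEquiv]

end IncidenceSystem

/-! ### Eigenvalues and independence of rows -/

namespace Matrix

/-- The elementary symmetric functions of the complex eigenvalues of an integral matrix. -/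
theorem charpoly_coeff_eq_esymm_roots {n : Type*} [Fintype n] [DecidableEq n] (M : Matrix n n ℤ)
    {k : ℕ} (hk : k ≤ Fintype.card n) :
    (((-1) ^ (Fintype.card n - k) * M.charpoly.coeff k : ℤ) : ℂ) =
      (M.map (Int.cast : ℤ → ℂ)).charpoly.roots.esymm (Fintype.card n - k) := by
  have hmap : (M.map (Int.cast : ℤ → ℂ)).charpoly = M.charpoly.map (Int.castRingHom ℂ) :=
    charpoly_map M (Int.castRingHom ℂ)
  have hdeg := (M.map (Int.cast : ℤ → ℂ)).charpoly_natDegree_eq_dim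
  have h := Polynomial.coeff_eq_esymm_roots_of_splits
    (IsAlgClosed.splits (M.map (Int.cast : ℤ → ℂ)).charpoly) (k := k) (hdeg ▸ hk)
  rw [hdeg, (charpoly_monic _).leadingCoeff, one_mul] at h
  push_cast
  have h' : (M.charpoly.coeff k : ℂ) = (M.map (Int.cast : ℤ → ℂ)).charpoly.coeff k := by
    rw [hmap, Polynomial.coeff_map]; rfl
  rw [h', h, ← mul_assoc, ← mul_pow]
  norm_num

/-- The rows of a matrix with right inverse are independent. -/
theorem linearIndependent_row_of_mulVec_surjective {R m n : Type*} [CommRing R] [Fintype m]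
    [Fintype n] [DecidableEq m] {A : Matrix m n R} (h : Function.Surjective A.mulVec) :
    LinearIndependent R A.row := by
  obtain ⟨B, hB⟩ := mulVec_surjective_iff_exists_right_inverse.1 h
  rw [← vecMul_injective_iff]
  intro x y hxy
  simpa [vecMul_vecMul, hB] using congrArg (· ᵥ* B) hxy

end Matrix

/-! ### Spanning coforests as row bases -/

namespace IncidenceSystem

open Matrix

variable {K : IncidenceSystem.{u}} {d n m : ℕ} {V W : Finset (K.cell d)}
  (b : Module.Basis (Fin n) ℤ (K.boundaries ℤ d))

/-- The matrix of the inclusion `B_d(X; ℤ) ⊆ C_d(X; ℤ)`. -/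
noncomputable def cellMatrix : Matrix (K.cell d) (Fin n) ℤ := Matrix.of fun s i => (b i : K.Chain ℤ d) s

/-- The matrix `cellMatrix` with rational entries. -/
noncomputable abbrev cellMatrixRat : Matrix (K.cell d) (Fin n) ℚ := (cellMatrix b).map (Int.castRingHom ℚ)

lemma meshMatrix_eq : meshMatrix b = (cellMatrix b)ᵀ * cellMatrix b := rfl

lemma kMatrix_eq (W : Finset (K.cell d)) :
    kMatrix b W = (cellMatrix b).submatrix Subtype.val id := by
  ext i j
  simp [kMatrix, LinearMap.toMatrix_apply, cellMatrix, kMap, restrict, LinearMap.funLeft]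

/-- The matrix of the integral cellular boundary. -/
def boundaryMatrix (K : IncidenceSystem.{u}) (d : ℕ) : Matrix (K.cell d) (K.cell (d + 1)) ℤ :=
  Matrix.of fun j i => K.incidence d i j

lemma boundary_int_apply (x : K.Chain ℤ (d + 1)) :
    K.boundary ℤ d x = boundaryMatrix K d *ᵥ x := by
  simp [boundary, boundaryMatrix]

lemma boundary_rat_apply (x : K.Chain ℚ (d + 1)) :
    K.boundary ℚ d x = (boundaryMatrix K d).map (Int.castRingHom ℚ) *ᵥ x := rfl

lemma exists_cellMatrix_eq_boundaryMatrix_mul :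
    ∃ F : Matrix (K.cell (d + 1)) (Fin n) ℤ, cellMatrix b = boundaryMatrix K d * F := by
  choose f hf using fun i => (b i).2
  refine ⟨Matrix.of fun s i => f i s, ?_⟩
  ext s i
  have := congrFun (hf i) s
  rw [boundary_int_apply] at this
  exact this.symm

lemma exists_boundaryMatrix_eq_cellMatrix_mul :
    ∃ E : Matrix (Fin n) (K.cell (d + 1)) ℤ, boundaryMatrix K d = cellMatrix b * E := by
  let x (j : K.cell (d + 1)) : K.boundaries ℤ d := ⟨K.boundary ℤ d (Pi.single j 1), ⟨_, rfl⟩⟩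
  refine ⟨Matrix.of fun i j => b.repr (x j) i, ?_⟩
  ext s j
  have h := congrArg (fun y : K.boundaries ℤ d => (y : K.Chain ℤ d) s) (b.sum_repr (x j))
  simp only [x, boundary_int_apply, mulVec_single_one, Submodule.coe_sum, Submodule.coe_smul,
    Finset.sum_apply, Pi.smul_apply, smul_eq_mul] at h
  refine h.symm.trans (Finset.sum_congr rfl fun i _ => (mul_comm _ _).trans ?_)
  simp only [← mulVec_single_one, ← boundary_int_apply]
  rfl

/-- The boundary matrix and the matrix of b factor through each other over ℤ, so their column spaces
over ℚ agree. This ties the integral basis to the rational definition of coforests. -/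
lemma boundaries_rat_eq_range : K.boundaries ℚ d = LinearMap.range (cellMatrixRat b).mulVecLin := by
  apply le_antisymm
  · obtain ⟨E, hE⟩ := exists_boundaryMatrix_eq_cellMatrix_mul b
    rintro _ ⟨x, rfl⟩
    rw [boundary_rat_apply, hE, Matrix.map_mul, ← mulVec_mulVec]
    exact ⟨_, rfl⟩
  · obtain ⟨F, hF⟩ := exists_cellMatrix_eq_boundaryMatrix_mul b
    rintro _ ⟨x, rfl⟩
    rw [mulVecLin_apply, cellMatrixRat, hF, Matrix.map_mul, ← mulVec_mulVec]
    exact ⟨_, boundary_rat_apply _⟩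

lemma cellMatrixRat_mulVec_injective : Function.Injective (cellMatrixRat b).mulVec := by
  rw [mulVec_injective_iff, ← LinearIndependent.iff_fractionRing ℤ ℚ]
  let f : K.Chain ℤ d →ₗ[ℤ] K.Chain ℚ d := (Int.castAddHom ℚ).toIntLinearMap.compLeft (K.cell d)
  have hf : Function.Injective f := fun x y h => funext fun i => Int.cast_injective (congrFun h i)
  exact (b.linearIndependent.map' (K.boundaries ℤ d).subtype (Submodule.ker_subtype _)).map' f
    (LinearMap.ker_eq_bot.2 hf)

lemma isSpanningCoforest_iff :
    IsSpanningCoforest V ↔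
      Function.Bijective ((cellMatrixRat b).submatrix (Subtype.val : V → K.cell d) id).mulVec := by
  let g : (Fin n → ℚ) → K.boundaries ℚ d := fun x =>
    ⟨cellMatrixRat b *ᵥ x, by rw [boundaries_rat_eq_range b]; exact ⟨x, rfl⟩⟩
  have hg : Function.Bijective g := by
    refine ⟨fun x y h => cellMatrixRat_mulVec_injective b (congrArg Subtype.val h), ?_⟩
    rintro ⟨y, hy⟩
    obtain ⟨x, hx⟩ := boundaries_rat_eq_range b ▸ hy
    exact ⟨x, Subtype.ext hx⟩
  exact (Function.Bijective.of_comp_iff (kMap ℚ V) hg).symm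

lemma IsSpanningCoforest.card_eq (hV : IsSpanningCoforest V)
    (b : Module.Basis (Fin n) ℤ (K.boundaries ℤ d)) : V.card = n := by
  have := (LinearEquiv.ofBijective
    ((cellMatrixRat b).submatrix (Subtype.val : V → K.cell d) id).mulVecLin
    ((isSpanningCoforest_iff b).1 hV)).finrank_eq
  simpa using this.symm

lemma IsSpanningCoforest.kMap_injective (hV : IsSpanningCoforest V) :
    Function.Injective (kMap ℤ V) := by
  rw [injective_iff_map_eq_zero]
  rintro ⟨_, ⟨x, rfl⟩⟩ h
  have hx : K.boundary ℚ d (fun i => (x i : ℚ)) = fun i => ((K.boundary ℤ d x i : ℤ) : ℚ) := by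
    rw [boundary_rat_apply, boundary_int_apply]
    exact funext fun i => (RingHom.map_mulVec (Int.castRingHom ℚ) _ _ i).symm
  have h0 : kMap ℚ V ⟨_, ⟨fun i => (x i : ℚ), rfl⟩⟩ = 0 := by
    ext i
    change K.boundary ℚ d (fun i => (x i : ℚ)) i = 0
    rw [hx]
    exact Int.cast_eq_zero.2 (congrFun h i)
  have h1 := congrArg Subtype.val (hV.1 (h0.trans (map_zero _).symm))
  refine Subtype.ext (funext fun i => Int.cast_injective (α := ℚ) ?_)
  exact (congrFun hx i).symm.trans ((congrFun h1 i).trans Int.cast_zero.symm)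

/-- The Gram determinant is an integer, so its vanishing may be tested over ℚ, where positivity of
the dot product applies. -/
lemma covolumeSq_ne_zero_iff :
    covolumeSq b W ≠ 0 ↔
      LinearIndependent ℚ ((cellMatrixRat b).submatrix (Subtype.val : W → K.cell d) id).row := by
  rw [linearIndependent_row_iff_det_mul_transpose_ne_zero, covolumeSq, kMatrix_eq, ne_eq, ne_eq,
    ← Int.cast_eq_zero (α := ℚ)]
  have : (((((cellMatrix b).submatrix (Subtype.val : W → K.cell d) id) *
      ((cellMatrix b).submatrix (Subtype.val : W → K.cell d) id)ᵀ).det : ℤ) : ℚ) =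
      (((cellMatrixRat b).submatrix (Subtype.val : W → K.cell d) id) *
      ((cellMatrixRat b).submatrix (Subtype.val : W → K.cell d) id)ᵀ).det := by
    refine ((Int.castRingHom ℚ).map_det _).trans ?_
    rw [RingHom.mapMatrix_apply, Matrix.map_mul]
    rfl
  rw [this]

lemma IsSpanningCoforest.covolumeSq_ne_zero (hV : IsSpanningCoforest V) (h : W ⊆ V) :
    covolumeSq b W ≠ 0 := by
  rw [covolumeSq_ne_zero_iff]
  refine (linearIndependent_row_of_mulVec_surjective ((isSpanningCoforest_iff b).1 hV).2).comp
    (fun i : W => ⟨i, h i.2⟩) fun _ _ e => Subtype.ext (congrArg (fun i : V => (i : K.cell d)) e)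

/-- A set of cells with nonzero covolume is contained in a spanning coforest. -/
lemma exists_isSpanningCoforest_of_covolumeSq_ne_zero (h : covolumeSq b W ≠ 0) :
    ∃ V, IsSpanningCoforest V ∧ W ⊆ V := by
  rw [covolumeSq_ne_zero_iff] at h
  -- V is an independent family of rows containing W whose span contains every row.
  obtain ⟨t, -, hWt, hspan, hli⟩ := exists_linearIndepOn_extension (K := ℚ)
    (v := (cellMatrixRat b).row) (s := (W : Set (K.cell d))) (t := Set.univ) h (Set.subset_univ _)
  obtain ⟨V, rfl⟩ := t.toFinite.exists_finset_coe
  refine ⟨V, (isSpanningCoforest_iff b).2 ⟨?_, ?_⟩, Finset.coe_subset.1 hWt⟩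
  · intro x y hxy
    apply cellMatrixRat_mulVec_injective b
    -- Vectors with equal products against the rows in V have equal products against their span,
    -- hence against all rows of A, which is injective.
    have hle : Submodule.span ℚ ((cellMatrixRat b).row '' (V : Set (K.cell d))) ≤
        LinearMap.eqLocus (dotProductBilin ℚ ℚ x) (dotProductBilin ℚ ℚ y) := by
      rw [Submodule.span_le]
      rintro _ ⟨i, hi, rfl⟩
      have := congrFun hxy ⟨i, hi⟩
      rw [mulVec, mulVec, dotProduct_comm, dotProduct_comm _ y] at this
      exact this
    ext i
    have : x ⬝ᵥ (cellMatrixRat b).row i = y ⬝ᵥ (cellMatrixRat b).row i :=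
      hle (hspan ⟨i, trivial, rfl⟩)
    rw [mulVec, mulVec, dotProduct_comm, dotProduct_comm _ y]
    exact this
  · have hdet := (linearIndependent_row_iff_det_mul_transpose_ne_zero
      ((cellMatrixRat b).submatrix (Subtype.val : V → K.cell d) id)).1 hli
    apply mulVec_surjective_iff_exists_right_inverse.2
    exact ⟨_, (Matrix.mul_assoc _ _ _).symm.trans
      (mul_nonsing_inv _ (isUnit_iff_ne_zero.2 hdet))⟩

/-! ### Orders as determinants, and covolumes of reduced coforests -/

lemma v_eq_natAbs_det (hV : IsSpanningCoforest V) (e : V ≃ Fin n) :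
    v V = ((kMatrix b V).submatrix id e).det.natAbs := by
  rw [v_eq_card_kCokernel, card_quotient_range_eq_natAbs_det b _ hV.kMap_injective e]
  rfl

/-- `det(k_V k_V^*) = v(V, X)²` for a spanning coforest. -/
lemma IsSpanningCoforest.covolumeSq_eq (hV : IsSpanningCoforest V) :
    covolumeSq b V = (v V : ℤ) ^ 2 := by
  let e : V ≃ Fin n := Fintype.equivFinOfCardEq ((Fintype.card_coe V).trans (hV.card_eq b))
  rw [v_eq_natAbs_det b hV e, Int.natCast_natAbs, sq_abs, sq]
  nth_rewrite 2 [← det_transpose]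
  rw [← det_mul, transpose_submatrix, submatrix_mul_equiv, submatrix_id_id, covolumeSq]

/-- Since `Nat.card` is 0 on infinite groups, this is the finiteness of H_d(X, X_{Vᶜ}); the
finiteness of the other groups follows from `v_eq_v_mul_u`. -/
lemma IsSpanningCoforest.v_ne_zero (hV : IsSpanningCoforest V) : v V ≠ 0 := by
  have h := hV.covolumeSq_ne_zero (Module.finBasis ℤ (K.boundaries ℤ d)) subset_rfl
  rw [hV.covolumeSq_eq] at h
  exact fun h0 => h (by simp [h0])

lemma IsSpanningCoforest.v_ne_zero_of_subset (hV : IsSpanningCoforest V) (h : W ⊆ V) : v W ≠ 0 :=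
  fun h0 => hV.v_ne_zero (by rw [v_eq_v_mul_u h, h0, zero_mul])

lemma IsSpanningCoforest.u_ne_zero (hV : IsSpanningCoforest V) (h : W ⊆ V) : u W V ≠ 0 :=
  fun h0 => hV.v_ne_zero (by rw [v_eq_v_mul_u h, h0, mul_zero])

lemma IsSpanningCoforest.finite_homologyRelCompl (hV : IsSpanningCoforest V) (h : W ⊆ V) :
    Finite (HomologyRelCompl W) :=
  Nat.finite_of_card_ne_zero (hV.v_ne_zero_of_subset h)

lemma IsSpanningCoforest.finite_yCokernel (hV : IsSpanningCoforest V) (h : W ⊆ V) :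
    Finite (YCokernel W V) :=
  Nat.finite_of_card_ne_zero (hV.u_ne_zero h)

/-- Elements of N_W vanish on W; one killed by y_W vanishes on all of V, where k_V is injective. -/
lemma IsSpanningCoforest.yMap_injective (hV : IsSpanningCoforest V) :
    Function.Injective (yMap W V) := by
  rw [injective_iff_map_eq_zero]
  intro z hz
  refine Subtype.ext (hV.kMap_injective (funext fun i => ?_))
  by_cases hi : (i : K.cell d) ∈ W
  · exact mem_chainsOn_skeletonWith_compl_iff.1 z.2 i hi
  · exact congrFun hz ⟨i, Finset.mem_sdiff.2 ⟨i.2, hi⟩⟩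

/-- The image of y_W has finite index, hence full rank. This makes the matrix of y_W square. -/
lemma IsSpanningCoforest.card_sdiff_eq_of_basis (hV : IsSpanningCoforest V) (h : W ⊆ V)
    (c : Module.Basis (Fin m) ℤ (boundariesOff W)) : (V \ W).card = m := by
  have hu : (LinearMap.range (yMap W V)).toAddSubgroup.index ≠ 0 := hV.u_ne_zero h
  obtain ⟨e⟩ := Int.submodule_toAddSubgroup_index_ne_zero_iff.1 hu
  have := ((LinearEquiv.ofInjective _ (hV.yMap_injective)).trans e).finrank_eq
  rw [Module.finrank_eq_card_basis c, Fintype.card_fin, Module.finrank_pi, Fintype.card_coe] at this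
  exact this.symm

/-- The decomposition of `V` into `W` and `V \ W`. -/
noncomputable def sumSdiffEquiv (h : W ⊆ V) : W ⊕ (V \ W : Finset (K.cell d)) ≃ V :=
  Equiv.ofBijective
    (Sum.elim (fun i => ⟨i, h i.2⟩) fun i => ⟨i, (Finset.mem_sdiff.1 i.2).1⟩) <| by
    constructor
    · rintro (⟨i, hi⟩ | ⟨i, hi⟩) (⟨j, hj⟩ | ⟨j, hj⟩) e <;> obtain rfl := congrArg Subtype.val e
      · rfl
      · exact absurd hi (Finset.mem_sdiff.1 hj).2
      · exact absurd hj (Finset.mem_sdiff.1 hi).2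
      · rfl
    · rintro ⟨i, hi⟩
      by_cases hW : i ∈ W
      · exact ⟨Sum.inl ⟨i, hW⟩, rfl⟩
      · exact ⟨Sum.inr ⟨i, Finset.mem_sdiff.2 ⟨hi, hW⟩⟩, rfl⟩

lemma fromRows_kMatrix (h : W ⊆ V) :
    fromRows (kMatrix b W) (kMatrix b (V \ W)) = (kMatrix b V).submatrix (sumSdiffEquiv h) id := by
  simp only [kMatrix_eq]
  ext (i | i) j <;> rfl

lemma kMatrix_mul_inclMatrix (c : Module.Basis (Fin m) ℤ (boundariesOff W)) :
    kMatrix b W * inclMatrix b c = 0 := by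
  rw [kMatrix, inclMatrix, ← LinearMap.toMatrix_comp]
  have : kMap ℤ W ∘ₗ (boundariesOff W).subtype = 0 := by
    ext z i
    exact mem_chainsOn_skeletonWith_compl_iff.1 z.2 i i.2
  rw [this, map_zero]

/-- `det(k_W k_W^*) u(W, V)² = v(V, X)² det(B'[W]ᵗ B'[W])`. -/
lemma IsSpanningCoforest.covolumeSq_mul_u_sq (hV : IsSpanningCoforest V) (h : W ⊆ V)
    (c : Module.Basis (Fin m) ℤ (boundariesOff W)) :
    covolumeSq b W * (u W V : ℤ) ^ 2 = (v V : ℤ) ^ 2 * inclGram b c := by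
  let e : V ≃ Fin n := Fintype.equivFinOfCardEq ((Fintype.card_coe V).trans (hV.card_eq b))
  let f : (V \ W : Finset (K.cell d)) ≃ Fin m :=
    Fintype.equivFinOfCardEq
      ((Fintype.card_coe _).trans (hV.card_sdiff_eq_of_basis h c))
  -- The matrix of y_W is the product Qc, as y_W is the restriction to V \ W after the inclusion
  -- x_W.
  have hu : (u W V : ℤ) ^ 2 =
      (kMatrix b (V \ W) * (inclMatrix b c).submatrix id f).det ^ 2 := by
    rw [u, card_quotient_range_eq_natAbs_det c _ (hV.yMap_injective) f, Int.natCast_natAbs,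
      sq_abs, yMap, LinearMap.toMatrix_comp c b, ← submatrix_mul_equiv _ _ id (Equiv.refl _) f]
    rfl
  have hv : (v V : ℤ) ^ 2 = ((fromRows (kMatrix b W) (kMatrix b (V \ W))).submatrix id
      ((sumSdiffEquiv h).trans e)).det ^ 2 := by
    rw [v_eq_natAbs_det b hV e, Int.natCast_natAbs, sq_abs, fromRows_kMatrix b h,
      ← det_submatrix_equiv_self (sumSdiffEquiv h)]
    rfl
  have hg : inclGram b c = (((inclMatrix b c).submatrix id f)ᵀ *
      (inclMatrix b c).submatrix id f).det := by
    rw [inclGram, ← det_submatrix_equiv_self f, ← submatrix_mul_equiv _ _ f (Equiv.refl _) f]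
    rfl
  rw [hu, hv, hg, det_fromRows_sq_mul_gram, covolumeSq]
  · ext i j
    exact congrFun (congrFun (kMatrix_mul_inclMatrix b c) i) (f j)
  · exact hV.covolumeSq_ne_zero b h

lemma IsSpanningCoforest.covolumeSq_eq_mul_inclGram (hV : IsSpanningCoforest V) (h : W ⊆ V)
    (c : Module.Basis (Fin m) ℤ (boundariesOff W)) :
    (covolumeSq b W : ℚ) = ((v V : ℚ) / u W V) ^ 2 * (inclGram b c : ℚ) := by
  have hu : (u W V : ℚ) ≠ 0 := Nat.cast_ne_zero.2 (hV.u_ne_zero h)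
  have := congrArg (Int.cast : ℤ → ℚ) (hV.covolumeSq_mul_u_sq b h c)
  push_cast at this
  field_simp
  linarith

/-- The right side does not involve V, which is the independence of f(W) from the coforest. -/
lemma IsSpanningCoforest.u_div_v (hV : IsSpanningCoforest V) (h : W ⊆ V) :
    (u W V : ℚ) / v V = 1 / v W := by
  have hu : (u W V : ℚ) ≠ 0 := Nat.cast_ne_zero.2 (hV.u_ne_zero h)
  have hw : (v W : ℚ) ≠ 0 := Nat.cast_ne_zero.2 (hV.v_ne_zero_of_subset h)
  rw [v_eq_v_mul_u h]
  push_cast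
  field_simp

/-! ### Summation over reduced coforests -/

lemma mem_reducedCoforests {k : ℕ} : W ∈ K.reducedCoforests d k ↔ IsReducedCoforest k W := by
  simp [reducedCoforests]

lemma mem_spanningCoforests : V ∈ K.spanningCoforests d ↔ IsSpanningCoforest V := by
  simp [spanningCoforests]

lemma spanningCoforests_eq : K.spanningCoforests d = K.reducedCoforests d 0 := by
  ext V
  rw [mem_spanningCoforests, mem_reducedCoforests]
  constructor
  · exact fun h => ⟨V, h, subset_rfl, by simp⟩
  · rintro ⟨V', h, hs, h0⟩
    rw [Finset.card_eq_zero, Finset.sdiff_eq_empty_iff_subset] at h0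
    rwa [hs.antisymm h0]

/-- The coefficients of the characteristic polynomial of the mesh matrix as sums of covolumes. -/
lemma charpoly_coeff_meshMatrix {k : ℕ} (hk : k ≤ n) :
    (-1) ^ (n - k) * (meshMatrix b).charpoly.coeff k =
      ∑ W ∈ K.reducedCoforests d k, covolumeSq b W := by
  have h := charpoly_coeff_transpose_mul_self (cellMatrix b) (j := n - k)
    ((Nat.sub_le _ _).trans_eq (Fintype.card_fin n).symm)
  rw [Fintype.card_fin, Nat.sub_sub_self hk] at h
  rw [meshMatrix_eq, h, ← mul_assoc, ← mul_pow, neg_one_mul, neg_neg, one_pow, one_mul]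
  symm
  refine (Finset.sum_subset (fun W hW => ?_) fun W hW hW' => ?_).trans
    (Finset.sum_congr rfl fun W _ => by rw [covolumeSq, kMatrix_eq])
  · obtain ⟨V, hV, hs, hc⟩ := mem_reducedCoforests.1 hW
    rw [Finset.card_sdiff_of_subset hs, hV.card_eq b] at hc
    have := (Finset.card_le_card hs).trans_eq (hV.card_eq b)
    exact Finset.mem_powersetCard.2 ⟨Finset.subset_univ _, by omega⟩
  -- A nonzero term lies in a coforest V with n cells, and n − (n − k) = k because k ≤ n, so it is
  -- k-reduced.
  · by_contra h0
    obtain ⟨V, hV, hs⟩ := exists_isSpanningCoforest_of_covolumeSq_ne_zero b h0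
    refine hW' (mem_reducedCoforests.2 ⟨V, hV, hs, ?_⟩)
    rw [Finset.card_sdiff_of_subset hs, hV.card_eq b, (Finset.mem_powersetCard.1 hW).2]
    omega

end IncidenceSystem

open IncidenceSystem in
theorem theorem2 {X : Type u} [TopologicalSpace X] [T2Space X] (C : Set X)
    [Topology.CWComplex C] [Topology.CWComplex.Finite C]
    (o : CWOrientation.Orientation C) (d : ℕ)
    (b : Module.Basis (Fin (o.system.boundaryRank d)) ℤ (o.system.boundaries ℤ d))
    (c : ∀ W : Finset (o.system.cell d),
      Module.Basis (Fin (Module.finrank ℤ (boundariesOff W))) ℤ (boundariesOff W)) :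
    -- determinant of the mesh matrix
    (∀ V : Finset (o.system.cell d), IsSpanningCoforest V → Finite (HomologyRelCompl V)) ∧
    ((-1) ^ o.system.boundaryRank d * (meshMatrix b).charpoly.coeff 0 = (meshMatrix b).det ∧
      ((meshMatrix b).det : ℂ) = (meshEigenvalues b).prod ∧
      ((meshMatrix b).det : ℂ) = (meshEigenvalues b).esymm (o.system.boundaryRank d) ∧
      (meshMatrix b).det = ∑ V ∈ o.system.spanningCoforests d, (v V : ℤ) ^ 2) ∧
    (∀ V : Finset (o.system.cell d), IsSpanningCoforest V → covolumeSq b V = (v V : ℤ) ^ 2) ∧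
    -- the finite groups attached to a `k`-reduced spanning coforest `W`
    (∀ (k : ℕ) (W : Finset (o.system.cell d)), IsReducedCoforest k W →
      Finite (HomologyRelCompl W) ∧
      Nonempty (((W → ℤ) ⧸ LinearMap.range (kMap ℤ W)) ≃ₗ[ℤ] HomologyRelCompl W)) ∧
    (∀ W V : Finset (o.system.cell d), IsSpanningCoforest V → W ⊆ V →
      Finite (YCokernel W V) ∧
      Nonempty (YCokernel W V ≃ₗ[ℤ] LinearMap.range
        (relHomologyMap (Set.subset_univ (skeletonWith Wᶜ)) (skeletonWith Vᶜ) d))) ∧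
    -- the quotient `f(W) = u(W,V) / v(V,X)`
    (∀ W V V' : Finset (o.system.cell d), IsSpanningCoforest V → W ⊆ V →
      IsSpanningCoforest V' → W ⊆ V' → (u W V : ℚ) / v V = (u W V' : ℚ) / v V') ∧
    (∀ W V : Finset (o.system.cell d), IsSpanningCoforest V → W ⊆ V →
      ∃ m : ℤ, (u W V : ℚ) / v V * v W = m) ∧
    -- the coefficients of the characteristic polynomial
    (∀ k < o.system.boundaryRank d,
      (((-1) ^ (o.system.boundaryRank d - k) * (meshMatrix b).charpoly.coeff k : ℤ) : ℂ) =
        (meshEigenvalues b).esymm (o.system.boundaryRank d - k) ∧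
      ∀ φ : Finset (o.system.cell d) → Finset (o.system.cell d),
        (∀ W, IsReducedCoforest k W → IsSpanningCoforest (φ W) ∧ W ⊆ φ W) →
        (((-1) ^ (o.system.boundaryRank d - k) * (meshMatrix b).charpoly.coeff k : ℤ) : ℚ) =
          ∑ W ∈ o.system.reducedCoforests d k,
            ((v (φ W) : ℚ) / u W (φ W)) ^ 2 * (inclGram b (c W) : ℚ)) ∧
    (∀ W V : Finset (o.system.cell d), IsSpanningCoforest V → W ⊆ V →
      (covolumeSq b W : ℚ) = ((v V : ℚ) / u W V) ^ 2 * (inclGram b (c W) : ℚ) ∧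
      ∃ m : ℤ, ((v V : ℚ) / u W V) ^ 2 * (inclGram b (c W) : ℚ) = m) := by
  have hW {k : ℕ} {W : Finset (o.system.cell d)} (h : IsReducedCoforest k W) :
      ∃ V, IsSpanningCoforest V ∧ W ⊆ V := h.imp fun V hV => ⟨hV.1, hV.2.1⟩
  have hesymm (k : ℕ) (hk : k ≤ o.system.boundaryRank d) :
      (((-1) ^ (o.system.boundaryRank d - k) * (meshMatrix b).charpoly.coeff k : ℤ) : ℂ) =
        (meshEigenvalues b).esymm (o.system.boundaryRank d - k) := by
    have := (meshMatrix b).charpoly_coeff_eq_esymm_roots (k := k) (by rwa [Fintype.card_fin])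
    rwa [Fintype.card_fin] at this
  have hdet : (-1) ^ o.system.boundaryRank d * (meshMatrix b).charpoly.coeff 0 =
      (meshMatrix b).det := by
    rw [Matrix.det_eq_sign_charpoly_coeff, Fintype.card_fin]
  refine ⟨fun V hV => hV.finite_homologyRelCompl subset_rfl, ⟨hdet, ?_, ?_, ?_⟩,
    fun V hV => hV.covolumeSq_eq b, fun k W h => ?_, fun W V hV h =>
      ⟨hV.finite_yCokernel h, ⟨yCokernelEquivRange h⟩⟩, fun W V V' hV h hV' h' => ?_,
    -- The integer f(W) v(W) is 1, since f(W) = 1/v(W).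
    fun W V hV h => ⟨1, ?_⟩, fun k hk => ⟨hesymm k hk.le, fun φ hφ => ?_⟩, fun W V hV h =>
      ⟨hV.covolumeSq_eq_mul_inclGram b h (c W), covolumeSq b W,
        (hV.covolumeSq_eq_mul_inclGram b h (c W)).symm⟩⟩
  · rw [meshEigenvalues, ← Matrix.det_eq_prod_roots_charpoly]
    exact (Int.castRingHom ℂ).map_det _
  · rw [← hdet]
    exact hesymm 0 (Nat.zero_le _)
  · rw [← hdet, spanningCoforests_eq]
    refine (charpoly_coeff_meshMatrix b (Nat.zero_le _)).trans (Finset.sum_congr rfl fun V hV => ?_)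
    rw [← spanningCoforests_eq, mem_spanningCoforests] at hV
    exact hV.covolumeSq_eq b
  · obtain ⟨V, hV, hs⟩ := hW h
    exact ⟨hV.finite_homologyRelCompl hs, ⟨(homologyRelComplEquiv W).symm⟩⟩
  · rw [hV.u_div_v h, hV'.u_div_v h']
  · rw [hV.u_div_v h, one_div, Int.cast_one,
      inv_mul_cancel₀ (Nat.cast_ne_zero.2 (hV.v_ne_zero_of_subset h))]
  -- The covolumes depend on W alone, so each term may be rewritten with its own coforest φ W.
  · rw [charpoly_coeff_meshMatrix b hk.le, Int.cast_sum]
    refine Finset.sum_congr rfl fun W hWk => ?_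
    obtain ⟨hV, h⟩ := hφ W (mem_reducedCoforests.1 hWk)
    exact hV.covolumeSq_eq_mul_inclGram b h (c W)
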